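/- Let $I\subset\mathbb{R}$ be a non-empty open interval (possibly unbounded), let $\gamma:I\to\mathbb{R}^d$ be real-analytic with $\dot\gamma(t)\neq 0$ for all $t\in I$, and let $\Gamma=\gamma(I)$. Write $D(x,y)=\|x-y\|^2$ for the squared Euclidean distance, and suppose that $[D,\Gamma]$ is simple, i.e. that 1. $\gamma$ is injective and $\dot\gamma$ vanishes nowhere on $I$; 2. $\ddot\gamma$ does not vanish identically on $I$; 3. $D$ is a distance polynomial for $\gamma$: it is a polynomial, $D(\gamma(\alpha),\gamma(\beta))=D(\gamma(\beta),\gamma(\alpha))$ for all $\alpha,\beta\in I$, and $D(\gamma(\alpha),\gamma(\beta))=0$ if and only if $\alpha=\beta$; 4. for all distinct $\alpha,\beta\in I$, the map $I\to\mathbb{R}^2$, $t\mapsto\big(D(\gamma(t),\gamma(\alpha)),D(\gamma(t),\gamma(\beta))\big)$, is injective; 5. the differential of $(\alpha,\beta)\mapsto D(\gamma(\alpha),\gamma(\beta))$ is non-zero at every point of $\{(\alpha,\beta)\in I^2:\alpha\neq\beta\}$. Call $\Gamma$ *$\mathcal{T}$-degenerate* if for any three distinct points $p_1,p_2,p_3\in\Gamma$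 there are $\delta>0$ and smooth maps $\Phi_1,\Phi_2,\Phi_3:(-\delta,\delta)\to\mathbb{R}^d$ with values in $\Gamma$ such that $\Phi_i(0)=p_i$ for each $i$, the three distances $\|\Phi_i(t)-\Phi_j(t)\|$ ($i\neq j$) do not depend on $t$, and $\Phi_i(t_0)\neq p_i$ for some $i$ and some $t_0\in(-\delta,\delta)$. Call $\Gamma$ a *generalized helix* if there are integers $k,l\ge 0$ with $l+2k\le d$, a real invertible skew-symmetric $2k\times 2k$ matrix $A$, vectors $v\in\mathbb{R}^{2k}$ and $w\in\mathbb{R}^l$, a non-empty open interval $J\subset\mathbb{R}$ and a rigid motion $R$ of $\mathbb{R}^d$ such that $$\Gamma=\{R(\exp(At)v,\;tw,\;0): t\in J\},\qquad (\exp(At)v,tw,0)\in\mathbb{R}^{2k}\times\mathbb{R}^l\times\mathbb{R}^{d-l-2k}=\mathbb{R}^d.$$ Then $\Gamma$ is $\mathcal{T}$-degenerate if and only if $\Gamma$ is a generalized helix. -/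

import Mathlib

open scoped ContDiff Matrix

namespace CurveRigidity

/-- A non-empty open interval of the real line, bounded or not. -/
def IsOpenInterval (I : Set ℝ) : Prop :=
  I.Nonempty ∧ IsOpen I ∧ I.OrdConnected

/-- The squared Euclidean distance on `ℝ^d`. -/
noncomputable def sqDist {d : ℕ} (x y : EuclideanSpace ℝ (Fin d)) : ℝ :=
  ‖x - y‖ ^ 2

/-- `D` is given by a real polynomial in the `2d` coordinates of its two arguments. -/
def IsPolynomialFun {d : ℕ} (D : EuclideanSpace ℝ (Fin d) → EuclideanSpace ℝ (Fin d) → ℝ) : Prop :=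
  ∃ p : MvPolynomial (Fin d ⊕ Fin d) ℝ, ∀ x y,
    D x y = MvPolynomial.eval (Sum.elim (fun i => x i) (fun i => y i)) p

/-- `D` is a distance polynomial for the parametrization `γ : I → ℝ^d`. -/
structure IsDistancePolynomial {d : ℕ}
    (D : EuclideanSpace ℝ (Fin d) → EuclideanSpace ℝ (Fin d) → ℝ)
    (I : Set ℝ) (γ : ℝ → EuclideanSpace ℝ (Fin d)) : Prop where
  polynomial : IsPolynomialFun D
  symm : ∀ α ∈ I, ∀ β ∈ I, D (γ α) (γ β) = D (γ β) (γ α)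
  eq_zero_iff : ∀ α ∈ I, ∀ β ∈ I, D (γ α) (γ β) = 0 ↔ α = β

/-- The pair `[D, Γ]` is simple, where `Γ` is the curve with the real-analytic parametrization
`γ : I → ℝ^d`, for a non-empty open interval `I`.
In `elekes_injOn` the parameters `α` and `β` are distinct: for `α = β` the map
`t ↦ ‖γ t - γ α‖ ^ 2` has an interior minimum at `α` and is never injective. -/
structure IsSimplePair {d : ℕ}
    (D : EuclideanSpace ℝ (Fin d) → EuclideanSpace ℝ (Fin d) → ℝ)
    (I : Set ℝ) (γ : ℝ → EuclideanSpace ℝ (Fin d)) : Prop where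
  injOn : Set.InjOn γ I
  deriv_ne_zero : ∀ t ∈ I, deriv γ t ≠ 0
  second_deriv_ne_zero : ∃ t ∈ I, deriv (deriv γ) t ≠ 0
  distancePolynomial : IsDistancePolynomial D I γ
  elekes_injOn : ∀ α ∈ I, ∀ β ∈ I, α ≠ β →
    Set.InjOn (fun t => (D (γ t) (γ α), D (γ t) (γ β))) I
  submersion : ∀ α ∈ I, ∀ β ∈ I, α ≠ β →
    fderiv ℝ (fun p : ℝ × ℝ => D (γ p.1) (γ p.2)) (α, β) ≠ 0

/-- The framework of the graph `G` on `M ⊆ ℝ^d` with vertex positions `φ` is `D`-smoothly flexible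
on `M`: there is a non-trivial smooth motion `Φ` of its vertices inside `M`, starting at `φ`, during
which the value of `D` along every edge of `G` is constant. -/
def IsSmoothlyFlexible {d : ℕ} {V : Type*}
    (D : EuclideanSpace ℝ (Fin d) → EuclideanSpace ℝ (Fin d) → ℝ)
    (G : SimpleGraph V) (M : Set (EuclideanSpace ℝ (Fin d)))
    (φ : V → EuclideanSpace ℝ (Fin d)) : Prop :=
  ∃ (δ : ℝ) (Φ : V → ℝ → EuclideanSpace ℝ (Fin d)), 0 < δ ∧
    (∀ v, ∀ t ∈ Set.Ioo (-δ) δ, Φ v t ∈ M) ∧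
    (∀ v, ContDiffOn ℝ ∞ (Φ v) (Set.Ioo (-δ) δ)) ∧
    (∀ v, Φ v 0 = φ v) ∧
    (∃ t₀ ∈ Set.Ioo (-δ) δ, ∃ v, Φ v t₀ ≠ φ v) ∧
    ∀ v w, G.Adj v w → ∀ t ∈ Set.Ioo (-δ) δ, D (Φ v t) (Φ w t) = D (φ v) (φ w)

/-- `Γ` is `(D, G)`-degenerate: every `G`-framework on `Γ` (an injective placement of the vertices
of `G` on `Γ`) is `D`-smoothly flexible on `Γ`. -/
def IsDegenerate {d : ℕ} {V : Type*}
    (D : EuclideanSpace ℝ (Fin d) → EuclideanSpace ℝ (Fin d) → ℝ)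
    (G : SimpleGraph V) (Γ : Set (EuclideanSpace ℝ (Fin d))) : Prop :=
  ∀ φ : V → EuclideanSpace ℝ (Fin d), Function.Injective φ → (∀ v, φ v ∈ Γ) →
    IsSmoothlyFlexible D G Γ φ

/-- The triangular graph: the complete graph on three vertices. -/
def triangle : SimpleGraph (Fin 3) := ⊤

/-- The point `(exp(At)v, tw, 0)` of `ℝ^{2k} × ℝ^l × ℝ^{d-l-2k} = ℝ^d` (for `l + 2k ≤ d`). -/
noncomputable def helixPoint (d k l : ℕ) (A : Matrix (Fin (2 * k)) (Fin (2 * k)) ℝ)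
    (v : Fin (2 * k) → ℝ) (w : Fin l → ℝ) (t : ℝ) : EuclideanSpace ℝ (Fin d) :=
  WithLp.toLp 2 fun i : Fin d =>
    if h : (i : ℕ) < 2 * k then (NormedSpace.exp (t • A) *ᵥ v) ⟨i, h⟩
    else if h' : (i : ℕ) - 2 * k < l then t * w ⟨i - 2 * k, h'⟩
    else 0

/-- The curve `Γ ⊆ ℝ^d`, given as a set of points, is a generalized helix: up to a rigid motion it is parametrized, on some
non-empty open interval, by `t ↦ (exp(At)v, tw, 0)` with `A` invertible and skew-symmetric. -/
def IsGeneralizedHelix {d : ℕ} (Γ : Set (EuclideanSpace ℝ (Fin d))) : Prop :=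
  ∃ (k l : ℕ) (A : Matrix (Fin (2 * k)) (Fin (2 * k)) ℝ) (v : Fin (2 * k) → ℝ) (w : Fin l → ℝ)
    (J : Set ℝ) (R : EuclideanSpace ℝ (Fin d) ≃ᵃⁱ[ℝ] EuclideanSpace ℝ (Fin d)),
    l + 2 * k ≤ d ∧ IsUnit A ∧ Aᵀ = -A ∧ IsOpenInterval J ∧
    Γ = (fun t => R (helixPoint d k l A v w t)) '' J

end CurveRigidity

/-! A generalized helix is an orbit arc of a one-parameter group of rigid motions, so translating
the parameter moves every framework on it rigidly (`sqDist_helixPoint_add`); the motion is not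
trivial because the helix has more than one point.

Conversely, let `Γ` be degenerate and let `c` be its parametrization by arc length. The squared
distances of three points of `Γ` form a map `tripleDist c : ℝ³ → ℝ³` of their parameters. A
non-trivial motion of a triple passes through a congruent triple at which this map is not locally
injective (`exists_congruent_singular`), so all its values on distinct parameters are critical
values, and by Sard's theorem its Jacobian determinant vanishes for all distinct parameters
(`det_halfJacobian_eq_zero`). With `g a b = ⟪c' a, c a - c b⟫` this reads
`g a b * g b e * g e a + g b a * g e b * g a e = 0`. To second order as `e` tends to `b`, the
identity says that the direction of the vector `(g a b, g b a)` is independent of `b`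
(`halfSlope_wronskian`). The vector does not vanish for `a ≠ b`, by the submersion condition of
simple pairs, and its direction tends to that of `(-1, 1)` as `b` decreases to `a`; hence
`g a b + g b a = 0`, that is, the distance of `c a` and `c b` depends only on `a - b`
(`halfSlope_add_eq_zero`).

Differentiating once in each variable gives `⟪c'' a, c' b⟫ = -⟪c' a, c'' b⟫`, so that `c'' = B c'`
for a skew-symmetric linear map `B` (`exists_skew_extension`), and `c' = B c + w₀`. In an
orthonormal basis adapted to the decomposition of `ℝ^d` into the range of `B`, where `B` is
invertible and whose dimension is therefore even, and the kernel of `B`, the solutions of this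
equation are the generalized helices (`isGeneralizedHelix_of_skew_ode`). -/

namespace CurveRigidity

/-! ### Reparametrization by arc length -/

lemma IsOpenInterval.isPreconnected {I : Set ℝ} (hI : IsOpenInterval I) : IsPreconnected I :=
  hI.2.2.isPreconnected

lemma hasDerivAt_of_contDiffOn {E : Type*} [NormedAddCommGroup E] [NormedSpace ℝ E]
    {f : ℝ → E} {J : Set ℝ} (hJ : IsOpen J) (hf : ContDiffOn ℝ ∞ f J) {t : ℝ} (ht : t ∈ J) :
    HasDerivAt f (deriv f t) t :=
  ((hf.differentiableOn (by simp)).differentiableAt (hJ.mem_nhds ht)).hasDerivAt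

lemma contDiffOn_deriv {E : Type*} [NormedAddCommGroup E] [NormedSpace ℝ E]
    {f : ℝ → E} {J : Set ℝ} (hJ : IsOpen J) (hf : ContDiffOn ℝ ∞ f J) :
    ContDiffOn ℝ ∞ (deriv f) J :=
  ((contDiffOn_infty_iff_deriv_of_isOpen hJ).1 hf).2

/-- A smooth positive function on an open interval is the derivative of a diffeomorphism onto
another open interval; `τ` is the inverse of that diffeomorphism. -/
lemma exists_smooth_time_change {I : Set ℝ} (hI : IsOpenInterval I) {v : ℝ → ℝ}
    (hv : ContDiffOn ℝ ∞ v I) (hpos : ∀ t ∈ I, 0 < v t) :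
    ∃ (J : Set ℝ) (τ : ℝ → ℝ), IsOpenInterval J ∧ ContDiffOn ℝ ∞ τ J ∧ Set.BijOn τ J I ∧
      ∀ t ∈ J, HasDerivAt τ (v (τ t))⁻¹ t := by
  obtain ⟨⟨t₀, ht₀⟩, hIo, hIc⟩ := hI
  set s : ℝ → ℝ := fun t => ∫ x in t₀..t, v x with hs
  have hds : ∀ t ∈ I, HasDerivAt s (v t) t := by
    intro t ht
    have hsub : Set.uIcc t₀ t ⊆ I := hIc.uIcc_subset ht₀ ht
    refine intervalIntegral.integral_hasDerivAt_right
      ((hv.continuousOn.mono hsub).intervalIntegrable)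
      (hv.continuousOn.stronglyMeasurableAtFilter hIo t ht)
      (hv.continuousOn.continuousAt (hIo.mem_nhds ht))
  have hsC : ContDiffOn ℝ ∞ s I := by
    rw [contDiffOn_infty_iff_deriv_of_isOpen hIo]
    exact ⟨fun t ht => (hds t ht).differentiableAt.differentiableWithinAt,
      hv.congr fun t ht => (hds t ht).deriv⟩
  have hstrict : ∀ t ∈ I, HasStrictDerivAt s (v t) t := fun t ht =>
    ((hsC.contDiffAt (hIo.mem_nhds ht)).hasStrictDerivAt' (hds t ht) (by simp))
  have hmono : StrictMonoOn s I := by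
    refine strictMonoOn_of_deriv_pos hIc.convex
      (fun t ht => (hds t ht).continuousAt.continuousWithinAt) ?_
    intro t ht
    rw [(hds t (interior_subset ht)).deriv]
    exact hpos t (interior_subset ht)
  let e : PartialEquiv ℝ ℝ := hmono.injOn.toPartialEquiv s I
  have heo : IsOpenMap (e.source.domRestrict e) := by
    rw [isOpenMap_iff_nhds_le]
    rintro ⟨t, ht⟩
    have h := (hstrict t ht).map_nhds_eq (hpos t ht).ne'
    have h2 : Filter.map (e.source.domRestrict e) (nhds ⟨t, ht⟩) = Filter.map s (nhds t) := by
      rw [← hIo.isOpenEmbedding_subtypeVal.map_nhds_eq ⟨t, ht⟩, Filter.map_map]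
      rfl
    rw [h2, h]
    exact le_rfl
  let f : OpenPartialHomeomorph ℝ ℝ := OpenPartialHomeomorph.ofContinuousOpenRestrict e
    hsC.continuousOn heo hIo
  have hJ : f.target = s '' I := rfl
  have hfs : ∀ t ∈ f.target, f.symm t ∈ I := fun t ht => f.map_target ht
  refine ⟨f.target, f.symm, ⟨⟨s t₀, t₀, ht₀, rfl⟩, f.open_target, ?_⟩, ?_, ?_, ?_⟩
  · rw [hJ]
    exact (hIc.isPreconnected.image s hsC.continuousOn).ordConnected
  · intro t ht
    exact (f.contDiffAt_symm_deriv (hpos _ (hfs t ht)).ne' ht (hds _ (hfs t ht))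
      (hsC.contDiffAt (hIo.mem_nhds (hfs t ht)))).contDiffWithinAt
  · exact f.symm.bijOn
  · intro t ht
    exact f.hasDerivAt_symm ht (hpos _ (hfs t ht)).ne' (hds _ (hfs t ht))

/-- Every regular smooth curve on an open interval has a reparametrization by arc length. -/
lemma exists_unitSpeed {d : ℕ} {I : Set ℝ} (hI : IsOpenInterval I)
    {γ : ℝ → EuclideanSpace ℝ (Fin d)} (hγ : ContDiffOn ℝ ∞ γ I)
    (hreg : ∀ t ∈ I, deriv γ t ≠ 0) :
    ∃ (J : Set ℝ) (τ : ℝ → ℝ), IsOpenInterval J ∧ ContDiffOn ℝ ∞ (γ ∘ τ) J ∧ Set.BijOn τ J I ∧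
      (∀ t ∈ J, HasDerivAt (γ ∘ τ) (‖deriv γ (τ t)‖⁻¹ • deriv γ (τ t)) t) ∧
      ∀ t ∈ J, ‖deriv (γ ∘ τ) t‖ = 1 := by
  obtain ⟨J, τ, hJ, hτ, hbij, hd⟩ := exists_smooth_time_change hI (v := fun t => ‖deriv γ t‖)
    ((contDiffOn_deriv hI.2.1 hγ).norm ℝ hreg) fun t ht => norm_pos_iff.2 (hreg t ht)
  have hder : ∀ t ∈ J, HasDerivAt (γ ∘ τ) (‖deriv γ (τ t)‖⁻¹ • deriv γ (τ t)) t := fun t ht =>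
    (hasDerivAt_of_contDiffOn hI.2.1 hγ (hbij.mapsTo ht)).scomp t (hd t ht)
  refine ⟨J, τ, hJ, hγ.comp hτ hbij.mapsTo, hbij, hder, fun t ht => ?_⟩
  rw [(hder t ht).deriv, norm_smul, norm_inv, norm_norm,
    inv_mul_cancel₀ (norm_ne_zero_iff.2 (hreg _ (hbij.mapsTo ht)))]

/-! ### Distances of triples of points and Sard's theorem -/

section Triples

variable {d : ℕ}

/-- Half the partial derivative of `‖c a - c b‖ ^ 2` with respect to `a`. -/
noncomputable def halfSlope (c : ℝ → EuclideanSpace ℝ (Fin d)) (a b : ℝ) : ℝ :=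
  inner ℝ (deriv c a) (c a - c b)

/-- The three squared distances of a triple of points on a curve, as a map `ℝ³ → ℝ³` of the
parameters. -/
noncomputable def tripleDist (c : ℝ → EuclideanSpace ℝ (Fin d)) (x : Fin 3 → ℝ) : Fin 3 → ℝ :=
  ![sqDist (c (x 0)) (c (x 1)), sqDist (c (x 0)) (c (x 2)), sqDist (c (x 1)) (c (x 2))]

/-- Half the Jacobian matrix of `tripleDist`. -/
noncomputable def halfJacobian (c : ℝ → EuclideanSpace ℝ (Fin d)) (x : Fin 3 → ℝ) :
    Matrix (Fin 3) (Fin 3) ℝ :=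
  !![halfSlope c (x 0) (x 1), halfSlope c (x 1) (x 0), 0;
     halfSlope c (x 0) (x 2), 0, halfSlope c (x 2) (x 0);
     0, halfSlope c (x 1) (x 2), halfSlope c (x 2) (x 1)]

lemma hasStrictFDerivAt_sqDist {c : ℝ → EuclideanSpace ℝ (Fin d)} {x : Fin 3 → ℝ} {i j : Fin 3}
    (hi : HasStrictDerivAt c (deriv c (x i)) (x i))
    (hj : HasStrictDerivAt c (deriv c (x j)) (x j)) :
    HasStrictFDerivAt (fun y : Fin 3 → ℝ => sqDist (c (y i)) (c (y j)))
      ((2 * halfSlope c (x i) (x j)) • ContinuousLinearMap.proj (R := ℝ) (φ := fun _ => ℝ) i +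
        (2 * halfSlope c (x j) (x i)) •
          ContinuousLinearMap.proj (R := ℝ) (φ := fun _ => ℝ) j) x := by
  have h1 := HasStrictFDerivAt.comp x (f := fun y : Fin 3 → ℝ => y i)
    hi.hasStrictFDerivAt (ContinuousLinearMap.proj (R := ℝ) (φ := fun _ => ℝ) i).hasStrictFDerivAt
  have h2 := HasStrictFDerivAt.comp x (f := fun y : Fin 3 → ℝ => y j)
    hj.hasStrictFDerivAt (ContinuousLinearMap.proj (R := ℝ) (φ := fun _ => ℝ) j).hasStrictFDerivAt
  refine ((hasStrictFDerivAt_norm_sq (c (x i) - c (x j))).comp x (h1.sub h2)).congr_fderiv ?_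
  ext y
  simp [halfSlope, inner_sub_right, real_inner_comm]
  ring

/-- The derivative of `tripleDist`. -/
noncomputable def tripleDeriv (c : ℝ → EuclideanSpace ℝ (Fin d)) (x : Fin 3 → ℝ) :
    (Fin 3 → ℝ) →L[ℝ] (Fin 3 → ℝ) :=
  LinearMap.toContinuousLinearMap (Matrix.toLin' ((2 : ℝ) • halfJacobian c x))

lemma det_tripleDeriv (c : ℝ → EuclideanSpace ℝ (Fin d)) (x : Fin 3 → ℝ) :
    (tripleDeriv c x).det = 8 * (halfJacobian c x).det := by
  rw [tripleDeriv, ContinuousLinearMap.det, LinearMap.coe_toContinuousLinearMap,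
    LinearMap.det_toLin', Matrix.det_smul]
  norm_num

lemma hasStrictFDerivAt_tripleDist {c : ℝ → EuclideanSpace ℝ (Fin d)} {x : Fin 3 → ℝ}
    (h : ∀ i, HasStrictDerivAt c (deriv c (x i)) (x i)) :
    HasStrictFDerivAt (tripleDist c) (tripleDeriv c x) x := by
  rw [hasStrictFDerivAt_pi']
  intro i
  fin_cases i
  · refine (hasStrictFDerivAt_sqDist (h 0) (h 1)).congr_fderiv ?_
    ext y
    simp [tripleDeriv, halfJacobian, Matrix.toLin'_apply, dotProduct,
      Fin.sum_univ_three]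
  · refine (hasStrictFDerivAt_sqDist (h 0) (h 2)).congr_fderiv ?_
    ext y
    simp [tripleDeriv, halfJacobian, Matrix.toLin'_apply, dotProduct,
      Fin.sum_univ_three]
  · refine (hasStrictFDerivAt_sqDist (h 1) (h 2)).congr_fderiv ?_
    ext y
    simp [tripleDeriv, halfJacobian, Matrix.toLin'_apply, dotProduct,
      Fin.sum_univ_three]

/-- A lift of a continuous motion through an injective curve is continuous as long as it stays
in a compact set of parameters. -/
lemma continuousWithinAt_lift {c : ℝ → EuclideanSpace ℝ (Fin d)} {K C : Set ℝ} {t : ℝ}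
    {Φ : ℝ → EuclideanSpace ℝ (Fin d)} {θ : ℝ → ℝ} (hK : IsCompact K)
    (hc : ∀ z ∈ K, ContinuousAt c z) (hinj : Set.InjOn c K) (ht : t ∈ C)
    (hΦ : ContinuousWithinAt Φ C t) (hθ : ∀ s ∈ C, θ s ∈ K) (hcθ : ∀ s ∈ C, c (θ s) = Φ s) :
    ContinuousWithinAt θ C t := by
  refine hK.tendsto_nhds_of_unique_mapClusterPt (Filter.eventually_of_mem self_mem_nhdsWithin hθ)
    fun z hz hcl => hinj hz (hθ t ht) ?_
  have h1 : MapClusterPt (c z) (nhdsWithin t C) (c ∘ θ) := hcl.tendsto_comp (hc z hz)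
  have h2 : Filter.Tendsto (c ∘ θ) (nhdsWithin t C) (nhds (Φ t)) :=
    hΦ.congr' (Filter.eventually_of_mem self_mem_nhdsWithin fun s hs => (hcθ s hs).symm)
  have h3 : ClusterPt (c z) (nhds (Φ t)) := ClusterPt.mono h1 h2
  rw [hcθ t ht]
  exact eq_of_nhds_neBot h3

/-- A non-constant smooth motion has non-zero velocity during some interval of times. -/
lemma exists_Icc_deriv_ne_zero {δ : ℝ} {Φ : ℝ → EuclideanSpace ℝ (Fin d)}
    (hΦ : ContDiffOn ℝ ∞ Φ (Set.Ioo (-δ) δ)) {t₀ : ℝ} (ht₀ : t₀ ∈ Set.Ioo (-δ) δ)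
    (hne : Φ t₀ ≠ Φ 0) :
    ∃ p q, p < q ∧ Set.Icc p q ⊆ Set.Ioo (-δ) δ ∧ ∀ t ∈ Set.Icc p q, deriv Φ t ≠ 0 := by
  have h0 : (0 : ℝ) ∈ Set.Ioo (-δ) δ := by
    have : 0 < δ := by linarith [ht₀.1, ht₀.2]
    simpa
  obtain ⟨t₁, ht₁, hd⟩ : ∃ t ∈ Set.Ioo (-δ) δ, deriv Φ t ≠ 0 := by
    by_contra! h
    exact hne (isOpen_Ioo.is_const_of_deriv_eq_zero isPreconnected_Ioo
      (hΦ.differentiableOn (by simp)) h ht₀ h0)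
  have hcont : ContinuousAt (deriv Φ) t₁ :=
    (contDiffOn_deriv isOpen_Ioo hΦ).continuousOn.continuousAt (isOpen_Ioo.mem_nhds ht₁)
  have hn : {t | t ∈ Set.Ioo (-δ) δ ∧ deriv Φ t ≠ 0} ∈ nhds t₁ :=
    Filter.inter_mem (isOpen_Ioo.mem_nhds ht₁) (hcont.eventually_ne hd)
  obtain ⟨ε, hε, hsub⟩ := Metric.nhds_basis_closedBall.mem_iff.1 hn
  rw [Real.closedBall_eq_Icc] at hsub
  exact ⟨t₁ - ε, t₁ + ε, by linarith, fun t ht => (hsub ht).1, fun t ht => (hsub ht).2⟩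

lemma sqDist_eq_zero_iff {x y : EuclideanSpace ℝ (Fin d)} : sqDist x y = 0 ↔ x = y := by
  simp [sqDist, sub_eq_zero]

lemma exists_accPt_of_countable_cover {p q : ℝ} (hpq : p < q) {ι : Type*} [Countable ι]
    {C : ι → Set ℝ}
    (hC : ∀ i, IsClosed (C i)) (hcov : Set.Icc p q ⊆ ⋃ i, C i) :
    ∃ i, ∃ t ∈ C i, AccPt t (Filter.principal (C i)) := by
  obtain ⟨i, hi⟩ : ∃ i, ¬ (C i).Countable := by
    by_contra! h
    exact Cardinal.Real.Icc_countable_iff.not.2 (not_le.2 hpq)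
      ((Set.countable_iUnion h).mono hcov)
  obtain ⟨D, hD, ⟨t, ht⟩, hDC⟩ := exists_perfect_nonempty_of_isClosed_of_not_countable (hC i) hi
  exact ⟨i, t, hDC ht, (hD.acc t ht).mono (Filter.principal_mono.2 hDC)⟩

/-- On a degenerate curve every triple is congruent to a triple at which the Jacobian of the
distances is singular. The parameters of the moving points need not depend continuously on time,
because the inverse of `c` need not be continuous; but the times at which they stay in
given compact sets form countably many closed sets, one of which has an accumulation point, and
at such a time the map `tripleDist` is not locally injective. -/
lemma exists_congruent_singular {J : Set ℝ} (hJ : IsOpen J)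
    {c : ℝ → EuclideanSpace ℝ (Fin d)} (hc : ContDiffOn ℝ ∞ c J) (hinj : Set.InjOn c J)
    (hdeg : IsDegenerate sqDist triangle (c '' J)) {x : Fin 3 → ℝ} (hx : ∀ i, x i ∈ J)
    (hxi : Function.Injective x) :
    ∃ y : Fin 3 → ℝ, (∀ i, y i ∈ J) ∧ Function.Injective y ∧ tripleDist c y = tripleDist c x ∧
      (halfJacobian c y).det = 0 := by
  obtain ⟨δ, Φ, hδ, hΦM, hΦs, hΦ0, ⟨t₀, ht₀, v, hv⟩, hΦd⟩ := hdeg (fun i => c (x i))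
    (fun i j hij => hxi (hinj (hx i) (hx j) hij)) fun i => ⟨x i, hx i, rfl⟩
  obtain ⟨p, q, hpq, hsub, hder⟩ := exists_Icc_deriv_ne_zero (hΦs v) ht₀ (by rwa [hΦ0])
  choose! θ hθJ hcθ using hΦM
  have hΦc : ∀ i, ContinuousOn (Φ i) (Set.Icc p q) := fun i => (hΦs i).continuousOn.mono hsub
  have hcont : ∀ z ∈ J, ContinuousAt c z := fun z hz =>
    hc.continuousOn.continuousAt (hJ.mem_nhds hz)
  -- an exhaustion of the parameter interval by countably many compact sets
  obtain ⟨K, hK, hKJ⟩ : IsSigmaCompact J := by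
    have : LocallyCompactSpace J := hJ.isOpenEmbedding_subtypeVal.locallyCompactSpace
    exact isSigmaCompact_iff_sigmaCompactSpace.2 inferInstance
  have hKsub : ∀ n, K n ⊆ J := fun n => hKJ ▸ Set.subset_iUnion K n
  let C : (Fin 3 → ℕ) → Set ℝ := fun m => ⋂ i, Set.Icc p q ∩ Φ i ⁻¹' (c '' K (m i))
  have hC : ∀ m, IsClosed (C m) := fun m => isClosed_iInter fun i =>
    (hΦc i).preimage_isClosed_of_isClosed isClosed_Icc
      ((hK (m i)).image_of_continuousOn (hc.continuousOn.mono (hKsub _))).isClosed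
  have hcov : Set.Icc p q ⊆ ⋃ m, C m := by
    intro t ht
    have h : ∀ i, ∃ n, θ i t ∈ K n := fun i => by
      have := hθJ i t (hsub ht)
      rw [← hKJ] at this
      exact Set.mem_iUnion.1 this
    choose m hm using h
    exact Set.mem_iUnion.2 ⟨m, Set.mem_iInter.2 fun i => ⟨ht, θ i t, hm i, hcθ i t (hsub ht)⟩⟩
  obtain ⟨m, t, htC, hacc⟩ := exists_accPt_of_countable_cover hpq hC hcov
  have hCI : C m ⊆ Set.Icc p q := fun s hs => (Set.mem_iInter.1 hs 0).1
  have hθK : ∀ i, ∀ s ∈ C m, θ i s ∈ K (m i) := by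
    intro i s hs
    obtain ⟨z, hz, hzs⟩ := (Set.mem_iInter.1 hs i).2
    rwa [hinj (hθJ i s (hsub (hCI hs))) (hKsub _ hz) ((hcθ i s (hsub (hCI hs))).trans hzs.symm)]
  have hθc : ∀ i, ContinuousWithinAt (θ i) (C m) t := fun i =>
    continuousWithinAt_lift (hK (m i)) (fun z hz => hcont z (hKsub _ hz)) (hinj.mono (hKsub _)) htC
      (((hΦc i) t (hCI htC)).mono hCI) (hθK i) fun s hs => hcθ i s (hsub (hCI hs))
  let Θ : ℝ → Fin 3 → ℝ := fun s i => θ i s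
  have hdist : ∀ s ∈ Set.Icc p q, ∀ i j : Fin 3, i ≠ j →
      sqDist (c (θ i s)) (c (θ j s)) = sqDist (c (x i)) (c (x j)) := by
    intro s hs i j hij
    rw [hcθ i s (hsub hs), hcθ j s (hsub hs)]
    exact hΦd i j (by simpa [triangle] using hij) s (hsub hs)
  have hF : ∀ s ∈ Set.Icc p q, tripleDist c (Θ s) = tripleDist c x := by
    intro s hs
    simp only [tripleDist, Θ]
    rw [hdist s hs 0 1 (by decide), hdist s hs 0 2 (by decide), hdist s hs 1 2 (by decide)]
  refine ⟨Θ t, fun i => hθJ i t (hsub (hCI htC)), ?_, hF t (hCI htC), ?_⟩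
  · intro i j hij
    by_contra hne
    have h1 := hdist t (hCI htC) i j hne
    have h2 : θ i t = θ j t := hij
    rw [h2, sqDist_eq_zero_iff.2 rfl, eq_comm, sqDist_eq_zero_iff] at h1
    exact hne (hxi (hinj (hx i) (hx j) h1))
  · by_contra hdet
    have hdet' : (tripleDeriv c (Θ t)).det ≠ 0 := by
      rw [det_tripleDeriv]
      exact mul_ne_zero (by norm_num) hdet
    have hst : HasStrictFDerivAt (tripleDist c)
        ((tripleDeriv c (Θ t)).toContinuousLinearEquivOfDetNeZero hdet' :
          (Fin 3 → ℝ) →L[ℝ] (Fin 3 → ℝ)) (Θ t) := by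
      rw [ContinuousLinearMap.coe_toContinuousLinearEquivOfDetNeZero]
      exact hasStrictFDerivAt_tripleDist fun i =>
        (hc.contDiffAt (hJ.mem_nhds (hθJ i t (hsub (hCI htC))))).hasStrictDerivAt (by simp)
    have hli := hst.eventually_left_inverse
    have hΘ : Filter.Tendsto Θ (nhdsWithin t (C m)) (nhds (Θ t)) := tendsto_pi_nhds.2 hθc
    have hconst : ∀ᶠ s in nhdsWithin t (C m), Θ s = Θ t := by
      filter_upwards [hΘ.eventually hli, self_mem_nhdsWithin] with s hs hsC
      rw [← hs, hF s (hCI hsC), ← hF t (hCI htC)]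
      exact hli.self_of_nhds
    -- the parameters are locally constant within `C m`, but the point `Φ v` has non-zero velocity
    have hne := (hasDerivAt_of_contDiffOn isOpen_Ioo (hΦs v) (hsub (hCI htC))).eventually_ne
      (c := Φ v t) (hder t (hCI htC))
    rw [accPt_iff_frequently_nhdsNE] at hacc
    refine (hacc.and_eventually hne) ?_
    have h2 : ∀ᶠ s in nhdsWithin t {t}ᶜ, s ∈ C m → Θ s = Θ t :=
      nhdsWithin_le_nhds (eventually_nhdsWithin_iff.1 hconst)
    filter_upwards [h2] with s hs hcon
    refine hcon.2 ?_
    rw [← hcθ v s (hsub (hCI hcon.1)), ← hcθ v t (hsub (hCI htC))]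
    exact congrArg c (congrFun (hs hcon.1) v)

lemma isOpen_injective_triples {J : Set ℝ} (hJ : IsOpen J) :
    IsOpen {x : Fin 3 → ℝ | (∀ i, x i ∈ J) ∧ Function.Injective x} := by
  have h : {x : Fin 3 → ℝ | (∀ i, x i ∈ J) ∧ Function.Injective x} =
      (⋂ i, (fun x : Fin 3 → ℝ => x i) ⁻¹' J) ∩
        ⋂ i, ⋂ j, {x : Fin 3 → ℝ | i ≠ j → x i ≠ x j} := by
    ext x
    simp only [Set.mem_ofPred_eq, Set.mem_inter_iff, Set.mem_iInter, Set.mem_preimage,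
      Function.Injective]
    exact and_congr_right fun _ =>
      ⟨fun h i j => mt (@h i j), fun h i j => not_imp_not.1 (h i j)⟩
  rw [h]
  refine (isOpen_iInter_of_finite fun i => hJ.preimage (continuous_apply i)).inter
    (isOpen_iInter_of_finite fun i => isOpen_iInter_of_finite fun j => ?_)
  by_cases hij : i = j
  · simp [hij]
  · simpa [hij] using isOpen_ne_fun (continuous_apply i) (continuous_apply j)

/-- On a degenerate curve the distances of a triple of points are never independent: by
`exists_congruent_singular` all values of `tripleDist` are critical values, so by Sard's theorem
they form a null set, whereas a triple with invertible Jacobian would provide an open set of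
values. -/
lemma det_halfJacobian_eq_zero {J : Set ℝ} (hJ : IsOpen J)
    {c : ℝ → EuclideanSpace ℝ (Fin d)} (hc : ContDiffOn ℝ ∞ c J) (hinj : Set.InjOn c J)
    (hdeg : IsDegenerate sqDist triangle (c '' J)) {x : Fin 3 → ℝ} (hx : ∀ i, x i ∈ J)
    (hxi : Function.Injective x) : (halfJacobian c x).det = 0 := by
  set S := {x : Fin 3 → ℝ | (∀ i, x i ∈ J) ∧ Function.Injective x}
  have hst : ∀ y ∈ S, HasStrictFDerivAt (tripleDist c) (tripleDeriv c y) y := fun y hy =>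
    hasStrictFDerivAt_tripleDist fun i =>
      (hc.contDiffAt (hJ.mem_nhds (hy.1 i))).hasStrictDerivAt (by simp)
  have hnull : MeasureTheory.volume (tripleDist c '' {y ∈ S | (halfJacobian c y).det = 0}) = 0 := by
    refine MeasureTheory.addHaar_image_eq_zero_of_det_fderivWithin_eq_zero _
      (f' := tripleDeriv c) (fun y hy => (hst y hy.1).hasFDerivAt.hasFDerivWithinAt) fun y hy => ?_
    rw [det_tripleDeriv, hy.2, mul_zero]
  have himg : tripleDist c '' S ⊆ tripleDist c '' {y ∈ S | (halfJacobian c y).det = 0} := by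
    rintro _ ⟨y, hy, rfl⟩
    obtain ⟨z, hzJ, hzi, hzy, hz⟩ := exists_congruent_singular hJ hc hinj hdeg hy.1 hy.2
    exact ⟨z, ⟨⟨hzJ, hzi⟩, hz⟩, hzy⟩
  by_contra hdet
  have hdet' : (tripleDeriv c x).det ≠ 0 := by
    rw [det_tripleDeriv]
    exact mul_ne_zero (by norm_num) hdet
  have h : HasStrictFDerivAt (tripleDist c)
      ((tripleDeriv c x).toContinuousLinearEquivOfDetNeZero hdet' :
        (Fin 3 → ℝ) →L[ℝ] (Fin 3 → ℝ)) x := by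
    rw [ContinuousLinearMap.coe_toContinuousLinearEquivOfDetNeZero]
    exact hst x ⟨hx, hxi⟩
  have hmem : tripleDist c '' S ∈ nhds (tripleDist c x) := by
    rw [← h.map_nhds_eq_of_equiv]
    exact Filter.image_mem_map ((isOpen_injective_triples hJ).mem_nhds ⟨hx, hxi⟩)
  exact (MeasureTheory.Measure.measure_pos_of_mem_nhds MeasureTheory.volume hmem).ne'
    (MeasureTheory.measure_mono_null himg hnull)

/-- The cyclic identity between the slopes of the three distances of a triple. -/
lemma cyclic_halfSlope {J : Set ℝ} (hJ : IsOpen J)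
    {c : ℝ → EuclideanSpace ℝ (Fin d)} (hc : ContDiffOn ℝ ∞ c J) (hinj : Set.InjOn c J)
    (hdeg : IsDegenerate sqDist triangle (c '' J)) {a b e : ℝ} (ha : a ∈ J) (hb : b ∈ J)
    (he : e ∈ J) (hab : a ≠ b) (hae : a ≠ e) (hbe : b ≠ e) :
    halfSlope c a b * halfSlope c b e * halfSlope c e a +
      halfSlope c b a * halfSlope c e b * halfSlope c a e = 0 := by
  have h := det_halfJacobian_eq_zero hJ hc hinj hdeg (x := ![a, b, e])
    (by intro i; fin_cases i <;> simpa)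
    (by
      intro i j hij
      fin_cases i <;> fin_cases j <;> simp_all)
  rw [Matrix.det_fin_three] at h
  simp [halfJacobian] at h
  linarith

end Triples

/-! ### Invariance of the distances under translation of the arc length -/

section Translation

open Filter Topology

/-- Half the second derivative at `b` of the vanishing function `A * (p * x) + B * (q * y)`, where
`p`, `q` and their second derivatives vanish at `b`. -/
lemma second_deriv_eq_zero {A B b x₂ y₂ : ℝ} {p q x y p' q' x' y' : ℝ → ℝ}
    (h : ∀ᶠ e in 𝓝 b, A * (p e * x e) + B * (q e * y e) = 0)
    (hp : ∀ᶠ e in 𝓝 b, HasDerivAt p (p' e) e) (hx : ∀ᶠ e in 𝓝 b, HasDerivAt x (x' e) e)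
    (hq : ∀ᶠ e in 𝓝 b, HasDerivAt q (q' e) e) (hy : ∀ᶠ e in 𝓝 b, HasDerivAt y (y' e) e)
    (hpb : p b = 0) (hqb : q b = 0) (hp' : HasDerivAt p' 0 b) (hq' : HasDerivAt q' 0 b)
    (hx' : HasDerivAt x' x₂ b) (hy' : HasDerivAt y' y₂ b) :
    A * (p' b * x' b) + B * (q' b * y' b) = 0 := by
  have h1 : ∀ᶠ e in 𝓝 b,
      A * (p' e * x e + p e * x' e) + B * (q' e * y e + q e * y' e) = 0 := by
    filter_upwards [h.eventually_nhds, hp, hx, hq, hy] with e he hpe hxe hqe hye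
    have hd := ((hpe.mul hxe).const_mul A).add ((hqe.mul hye).const_mul B)
    exact hd.unique ((hasDerivAt_const e (0 : ℝ)).congr_of_eventuallyEq he)
  have hd := (((hp'.mul hx.self_of_nhds).add (hp.self_of_nhds.mul hx')).const_mul A).add
    (((hq'.mul hy.self_of_nhds).add (hq.self_of_nhds.mul hy')).const_mul B)
  have h2 := hd.unique ((hasDerivAt_const b (0 : ℝ)).congr_of_eventuallyEq h1)
  rw [hpb, hqb] at h2
  linarith

/-- If the vector `(u, w)` does not vanish and has constant direction (zero Wronskian) to the right
of `a`, and starts from `0` at `a` with velocity `(-1, 1)`, then its direction is that of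
`(-1, 1)`. -/
lemma add_eq_zero_of_wronskian {S : Set ℝ} (hS : IsOpen S) (hSp : IsPreconnected S)
    {u w u' w' : ℝ → ℝ} (hu : ∀ b ∈ S, HasDerivAt u (u' b) b) (hw : ∀ b ∈ S, HasDerivAt w (w' b) b)
    (hW : ∀ b ∈ S, u b * w' b = w b * u' b) (hne : ∀ b ∈ S, u b ^ 2 + w b ^ 2 ≠ 0) {a : ℝ}
    (ha : ∀ᶠ b in 𝓝[>] a, b ∈ S) (hua : HasDerivAt u (-1) a) (hwa : HasDerivAt w 1 a)
    (hu0 : u a = 0) (hw0 : w a = 0) {b : ℝ} (hb : b ∈ S) : u b + w b = 0 := by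
  -- this quotient depends only on the direction of `(u, w)`, so it is constant; its limit at `a` is
  -- its value `0` at `(-1, 1)`
  have hd : ∀ b ∈ S, HasDerivAt (fun b => (u b + w b) ^ 2 / (u b ^ 2 + w b ^ 2)) 0 b := by
    intro b hb
    refine ((((hu b hb).add (hw b hb)).pow 2).div
      (((hu b hb).pow 2).add ((hw b hb).pow 2)) (hne b hb)).congr_deriv ?_
    rw [div_eq_zero_iff]
    left
    simp only [Pi.add_apply, Pi.pow_apply]
    linear_combination (2 * (u b + w b) * (u b - w b)) * hW b hb
  obtain ⟨C, hC⟩ := hS.exists_is_const_of_deriv_eq_zero hSp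
    (fun b hb => (hd b hb).differentiableAt.differentiableWithinAt) fun b hb => (hd b hb).deriv
  have hC' : ∀ b ∈ S, (u b + w b) ^ 2 = C * (u b ^ 2 + w b ^ 2) := fun b hb =>
    (div_eq_iff (hne b hb)).1 (hC b hb)
  have hle : 𝓝[>] a ≤ 𝓝[≠] a := nhdsWithin_mono a fun x hx => ne_of_gt hx
  have hus := (hasDerivAt_iff_tendsto_slope.1 hua).mono_left hle
  have hws := (hasDerivAt_iff_tendsto_slope.1 hwa).mono_left hle
  have hlim := tendsto_nhds_unique_of_eventuallyEq ((hus.add hws).pow 2)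
    (((hus.pow 2).add (hws.pow 2)).const_mul C) (by
      filter_upwards [ha] with b hb
      simp only [slope_def_field, hu0, hw0, sub_zero]
      rw [← add_div, div_pow, div_pow, div_pow, ← add_div, hC' b hb, mul_div_assoc])
  have hC0 : C = 0 := by linarith
  have h := hC' b hb
  rw [hC0, zero_mul] at h
  exact pow_eq_zero_iff (two_ne_zero) |>.1 h

variable {d : ℕ} {J : Set ℝ} {c : ℝ → EuclideanSpace ℝ (Fin d)}

lemma halfSlope_self (a : ℝ) : halfSlope c a a = 0 := by simp [halfSlope]

lemma hasDerivAt_halfSlope_left (hJ : IsOpen J) (hc : ContDiffOn ℝ ∞ c J)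
    (hunit : ∀ t ∈ J, ‖deriv c t‖ = 1) {a : ℝ} (b : ℝ) (ha : a ∈ J) :
    HasDerivAt (fun a => halfSlope c a b) (inner ℝ (deriv (deriv c) a) (c a - c b) + 1) a := by
  refine ((hasDerivAt_of_contDiffOn hJ (contDiffOn_deriv hJ hc) ha).inner ℝ
    ((hasDerivAt_of_contDiffOn hJ hc ha).sub_const (c b))).congr_deriv ?_
  rw [real_inner_self_eq_norm_sq, hunit a ha]
  ring

lemma hasDerivAt_halfSlope_right (hJ : IsOpen J) (hc : ContDiffOn ℝ ∞ c J) (a : ℝ) {b : ℝ}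
    (hb : b ∈ J) :
    HasDerivAt (fun b => halfSlope c a b) (-inner ℝ (deriv c a) (deriv c b)) b := by
  refine ((hasDerivAt_const b (deriv c a)).inner ℝ
    ((hasDerivAt_of_contDiffOn hJ hc hb).const_sub (c a))).congr_deriv ?_
  simp

lemma inner_deriv_deriv_deriv (hJ : IsOpen J) (hc : ContDiffOn ℝ ∞ c J)
    (hunit : ∀ t ∈ J, ‖deriv c t‖ = 1) {b : ℝ} (hb : b ∈ J) :
    inner ℝ (deriv c b) (deriv (deriv c) b) = 0 := by
  have h1 := (hasDerivAt_of_contDiffOn hJ (contDiffOn_deriv hJ hc) hb).norm_sq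
  have h2 : (fun t => ‖deriv c t‖ ^ 2) =ᶠ[𝓝 b] fun _ => 1 := by
    filter_upwards [hJ.mem_nhds hb] with t ht
    rw [hunit t ht, one_pow]
  have h3 := h1.unique ((hasDerivAt_const b (1 : ℝ)).congr_of_eventuallyEq h2)
  linarith

/-- The direction of the vector `(halfSlope c a b, halfSlope c b a)` does not depend on `b`. This
is the cyclic identity for a triple `a, b, e`, to second order as `e` tends to `b`. -/
lemma halfSlope_wronskian (hJ : IsOpen J) (hc : ContDiffOn ℝ ∞ c J)
    (hunit : ∀ t ∈ J, ‖deriv c t‖ = 1)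
    (hcyc : ∀ a ∈ J, ∀ b ∈ J, ∀ e ∈ J, a ≠ b → a ≠ e → b ≠ e →
      halfSlope c a b * halfSlope c b e * halfSlope c e a +
        halfSlope c b a * halfSlope c e b * halfSlope c a e = 0)
    {a b : ℝ} (ha : a ∈ J) (hb : b ∈ J) (hab : a ≠ b) :
    halfSlope c a b * (inner ℝ (deriv (deriv c) b) (c b - c a) + 1) =
      halfSlope c b a * (-inner ℝ (deriv c a) (deriv c b)) := by
  have hc1 := contDiffOn_deriv hJ hc
  have hc2 := contDiffOn_deriv hJ hc1
  have hT := hasDerivAt_of_contDiffOn hJ hc hb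
  have hN := hasDerivAt_of_contDiffOn hJ hc1 hb
  have hM := hasDerivAt_of_contDiffOn hJ hc2 hb
  have hJb := hJ.mem_nhds hb
  have h := second_deriv_eq_zero (A := halfSlope c a b) (B := halfSlope c b a) (b := b)
    (p := fun e => halfSlope c b e) (x := fun e => halfSlope c e a)
    (q := fun e => halfSlope c e b) (y := fun e => halfSlope c a e)
    (p' := fun e => -inner ℝ (deriv c b) (deriv c e))
    (x' := fun e => inner ℝ (deriv (deriv c) e) (c e - c a) + 1)
    (q' := fun e => inner ℝ (deriv (deriv c) e) (c e - c b) + 1)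
    (y' := fun e => -inner ℝ (deriv c a) (deriv c e))
    (by
      filter_upwards [hJb, eventually_ne_nhds hab.symm] with e he hea
      rcases eq_or_ne b e with rfl | hbe
      · simp [halfSlope_self]
      · linarith [hcyc a ha b hb e he hab hea.symm hbe])
    (eventually_of_mem hJb fun e he => hasDerivAt_halfSlope_right hJ hc b he)
    (eventually_of_mem hJb fun e he => hasDerivAt_halfSlope_left hJ hc hunit a he)
    (eventually_of_mem hJb fun e he => hasDerivAt_halfSlope_left hJ hc hunit b he)
    (eventually_of_mem hJb fun e he => hasDerivAt_halfSlope_right hJ hc a he)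
    (halfSlope_self b) (halfSlope_self b)
    ((((hasDerivAt_const b (deriv c b)).inner ℝ hN).neg).congr_deriv (by
      simp [inner_deriv_deriv_deriv hJ hc hunit hb]))
    (((hM.inner ℝ (hT.sub_const (c b))).add_const 1).congr_deriv (by
      rw [real_inner_comm, inner_deriv_deriv_deriv hJ hc hunit hb]
      simp))
    ((hM.inner ℝ (hT.sub_const (c a))).add_const 1)
    (((hasDerivAt_const b (deriv c a)).inner ℝ hN).neg)
  simp only [sub_self, inner_zero_right, zero_add, one_mul, real_inner_self_eq_norm_sq,
    hunit b hb] at h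
  linarith

lemma halfSlope_add_eq_zero_of_lt (hJ : IsOpenInterval J) (hc : ContDiffOn ℝ ∞ c J)
    (hunit : ∀ t ∈ J, ‖deriv c t‖ = 1)
    (hcyc : ∀ a ∈ J, ∀ b ∈ J, ∀ e ∈ J, a ≠ b → a ≠ e → b ≠ e →
      halfSlope c a b * halfSlope c b e * halfSlope c e a +
        halfSlope c b a * halfSlope c e b * halfSlope c a e = 0)
    (hsub : ∀ a ∈ J, ∀ b ∈ J, a ≠ b → halfSlope c a b ≠ 0 ∨ halfSlope c b a ≠ 0)
    {a b : ℝ} (ha : a ∈ J) (hb : b ∈ J) (hab : a < b) :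
    halfSlope c a b + halfSlope c b a = 0 := by
  obtain ⟨-, hJo, hJc⟩ := hJ
  refine add_eq_zero_of_wronskian (S := J ∩ Set.Ioi a) (a := a) (hJo.inter isOpen_Ioi)
    (hJc.inter Set.ordConnected_Ioi).isPreconnected
    (u := fun b => halfSlope c a b) (w := fun b => halfSlope c b a)
    (fun b hb => hasDerivAt_halfSlope_right hJo hc a hb.1)
    (fun b hb => hasDerivAt_halfSlope_left hJo hc hunit a hb.1)
    (fun b hb => halfSlope_wronskian hJo hc hunit hcyc ha hb.1 (ne_of_lt hb.2))
    ?_ ?_ ?_ ?_ (halfSlope_self a) (halfSlope_self a) ⟨hb, hab⟩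
  · intro b hb
    rcases hsub a ha b hb.1 (ne_of_lt hb.2) with h | h
    · positivity
    · positivity
  · exact inter_mem (nhdsWithin_le_nhds (hJo.mem_nhds ha)) self_mem_nhdsWithin
  · refine (hasDerivAt_halfSlope_right hJo hc a ha).congr_deriv ?_
    rw [real_inner_self_eq_norm_sq, hunit a ha, one_pow]
  · refine (hasDerivAt_halfSlope_left hJo hc hunit a ha).congr_deriv ?_
    simp

/-- In the arc length parameter the distances are infinitesimally invariant under translation. -/
lemma halfSlope_add_eq_zero (hJ : IsOpenInterval J) (hc : ContDiffOn ℝ ∞ c J)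
    (hunit : ∀ t ∈ J, ‖deriv c t‖ = 1)
    (hcyc : ∀ a ∈ J, ∀ b ∈ J, ∀ e ∈ J, a ≠ b → a ≠ e → b ≠ e →
      halfSlope c a b * halfSlope c b e * halfSlope c e a +
        halfSlope c b a * halfSlope c e b * halfSlope c a e = 0)
    (hsub : ∀ a ∈ J, ∀ b ∈ J, a ≠ b → halfSlope c a b ≠ 0 ∨ halfSlope c b a ≠ 0)
    {a b : ℝ} (ha : a ∈ J) (hb : b ∈ J) :
    halfSlope c a b + halfSlope c b a = 0 := by
  rcases lt_trichotomy a b with h | rfl | h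
  · exact halfSlope_add_eq_zero_of_lt hJ hc hunit hcyc hsub ha hb h
  · simp [halfSlope_self]
  · rw [add_comm]
    exact halfSlope_add_eq_zero_of_lt hJ hc hunit hcyc hsub hb ha h

/-- The mixed second derivative of `halfSlope_add_eq_zero`. -/
lemma inner_second_deriv_skew (hJ : IsOpen J) (hc : ContDiffOn ℝ ∞ c J)
    (hunit : ∀ t ∈ J, ‖deriv c t‖ = 1)
    (h : ∀ a ∈ J, ∀ b ∈ J, halfSlope c a b + halfSlope c b a = 0)
    {a b : ℝ} (ha : a ∈ J) (hb : b ∈ J) :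
    inner ℝ (deriv (deriv c) a) (deriv c b) = -inner ℝ (deriv c a) (deriv (deriv c) b) := by
  have h1 : ∀ b ∈ J, inner ℝ (deriv (deriv c) a) (c a - c b) + 1 +
      -inner ℝ (deriv c b) (deriv c a) = 0 := by
    intro b hb
    have hd := (hasDerivAt_halfSlope_left hJ hc hunit b ha).add
      (hasDerivAt_halfSlope_right hJ hc b ha)
    exact hd.unique ((hasDerivAt_const a (0 : ℝ)).congr_of_eventuallyEq
      (eventually_of_mem (hJ.mem_nhds ha) fun e he => h e he b hb))
  have hd := ((((hasDerivAt_const b (deriv (deriv c) a)).inner ℝ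
    ((hasDerivAt_of_contDiffOn hJ hc hb).const_sub (c a))).add_const 1).add
    (((hasDerivAt_of_contDiffOn hJ (contDiffOn_deriv hJ hc) hb).inner ℝ
      (hasDerivAt_const b (deriv c a))).neg))
  have h2 := hd.unique ((hasDerivAt_const b (0 : ℝ)).congr_of_eventuallyEq
      (eventually_of_mem (hJ.mem_nhds hb) h1))
  simp only [inner_neg_right, inner_zero_left, inner_zero_right, add_zero, zero_add] at h2
  rw [real_inner_comm (deriv (deriv c) b)]
  linarith

end Translation

/-! ### Skew-symmetric linear maps -/

section Skew

lemma inner_linearCombination_skew {E ι : Type*} [NormedAddCommGroup E] [InnerProductSpace ℝ E]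
    {f g : ι → E} (h : ∀ i j, inner ℝ (g i) (f j) = -inner ℝ (f i) (g j)) (p q : ι →₀ ℝ) :
    inner ℝ (Finsupp.linearCombination ℝ g p) (Finsupp.linearCombination ℝ f q) =
      -inner ℝ (Finsupp.linearCombination ℝ f p) (Finsupp.linearCombination ℝ g q) := by
  induction p using Finsupp.induction_linear with
  | zero => simp
  | add p₁ p₂ h₁ h₂ => rw [map_add, map_add, inner_add_left, inner_add_left, h₁, h₂]; ring
  | single i a =>
    induction q using Finsupp.induction_linear with
    | zero => simp
    | add q₁ q₂ h₁ h₂ => rw [map_add, map_add, inner_add_right, inner_add_right, h₁, h₂]; ring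
    | single j b => simp [real_inner_smul_left, real_inner_smul_right, h]

/-- An assignment `f i ↦ g i` which is skew-symmetric on the vectors `f i` extends to a
skew-symmetric linear map. The extension vanishes on the orthogonal complement of the span. -/
lemma exists_skew_extension {E ι : Type*} [NormedAddCommGroup E] [InnerProductSpace ℝ E]
    [FiniteDimensional ℝ E] {f g : ι → E}
    (h : ∀ i j, inner ℝ (g i) (f j) = -inner ℝ (f i) (g j))
    (hg : ∀ i, g i ∈ Submodule.span ℝ (Set.range f)) :
    ∃ B : E →ₗ[ℝ] E, (∀ x y, inner ℝ (B x) y = -inner ℝ x (B y)) ∧ ∀ i, B (f i) = g i := by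
  set F := Finsupp.linearCombination ℝ f with hF
  set G := Finsupp.linearCombination ℝ g with hG
  have hFr : LinearMap.range F = Submodule.span ℝ (Set.range f) :=
    Finsupp.range_linearCombination ℝ
  have hGV : ∀ p, G p ∈ LinearMap.range F := by
    intro p
    rw [hFr]
    have : LinearMap.range G ≤ Submodule.span ℝ (Set.range f) := by
      rw [hG, Finsupp.range_linearCombination, Submodule.span_le]
      rintro _ ⟨i, rfl⟩
      exact hg i
    exact this ⟨p, rfl⟩
  have hker : ∀ p, F p = 0 → G p = 0 := by
    intro p hp
    obtain ⟨q, hq⟩ := hGV p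
    have := inner_linearCombination_skew h p q
    rw [← hF, ← hG, hp, hq, inner_zero_left, neg_zero] at this
    exact inner_self_eq_zero.1 this
  obtain ⟨s, hs⟩ := F.rangeRestrict.exists_rightInverse_of_surjective F.range_rangeRestrict
  have hFs : ∀ v : LinearMap.range F, F (s v) = v := fun v =>
    congrArg Subtype.val (LinearMap.congr_fun hs v)
  let V := LinearMap.range F
  have hpr : ∀ x y : E, y ∈ V → inner ℝ x y = inner ℝ (V.orthogonalProjectionOnto x : E) y := by
    intro x y hy
    have := Submodule.inner_left_of_mem_orthogonal hy (V.sub_starProjection_mem_orthogonal x)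
    rw [inner_sub_left, sub_eq_zero] at this
    exact this
  refine ⟨G ∘ₗ s ∘ₗ V.orthogonalProjectionOnto.toLinearMap, fun x y => ?_, fun i => ?_⟩
  · simp only [LinearMap.comp_apply, ContinuousLinearMap.coe_coe]
    rw [hpr x _ (hGV _), real_inner_comm, hpr y _ (hGV _), real_inner_comm, ← hFs, ← hFs]
    have := inner_linearCombination_skew h (s (V.orthogonalProjectionOnto x))
      (s (V.orthogonalProjectionOnto y))
    rw [← hF, ← hG] at this
    simpa [hFs] using this
  · have hi : f i ∈ V := ⟨Finsupp.single i 1, by simp [hF]⟩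
    have h1 : F (s ⟨f i, hi⟩ - Finsupp.single i 1) = 0 := by
      rw [map_sub, hFs]
      simp [hF]
    have h2 := hker _ h1
    rw [map_sub, sub_eq_zero] at h2
    have h3 : V.orthogonalProjectionOnto (f i) = ⟨f i, hi⟩ :=
      Submodule.orthogonalProjectionOnto_mem_subspace_eq_self (⟨f i, hi⟩ : V)
    simp only [LinearMap.comp_apply, ContinuousLinearMap.coe_coe]
    rw [h3, h2]
    simp [hG]

/-- An invertible skew-symmetric real matrix has even size. -/
lemma even_of_skew_invertible {n : ℕ} {A : Matrix (Fin n) (Fin n) ℝ} (hA : IsUnit A)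
    (hskew : Aᵀ = -A) : Even n := by
  have hdet : A.det ≠ 0 := ((Matrix.isUnit_iff_isUnit_det A).1 hA).ne_zero
  have h : A.det = (-1) ^ n * A.det := by
    conv_lhs => rw [← Matrix.det_transpose, hskew, Matrix.det_neg, Fintype.card_fin]
  by_contra hn
  rw [Nat.not_even_iff_odd] at hn
  rw [hn.neg_one_pow] at h
  exact hdet (by linarith)

/-- In an orthonormal basis adapted to its range, a skew-symmetric linear map is given by an
invertible skew-symmetric matrix, because its kernel is the orthogonal complement of its range. -/
lemma exists_adapted_basis {d : ℕ}
    {B : EuclideanSpace ℝ (Fin d) →ₗ[ℝ] EuclideanSpace ℝ (Fin d)}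
    (hB : ∀ x y, inner ℝ (B x) y = -inner ℝ x (B y)) :
    ∃ (k : ℕ) (hk : 2 * k ≤ d) (b : OrthonormalBasis (Fin d) ℝ (EuclideanSpace ℝ (Fin d)))
      (A : Matrix (Fin (2 * k)) (Fin (2 * k)) ℝ), IsUnit A ∧ Aᵀ = -A ∧
      (∀ x i, inner ℝ (b (Fin.castLE hk i)) (B x) =
        (A *ᵥ fun j => inner ℝ (b (Fin.castLE hk j)) x) i) ∧
      ∀ x, ∀ i : Fin d, 2 * k ≤ i → inner ℝ (b i) (B x) = 0 := by
  set V := LinearMap.range B with hV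
  obtain ⟨n, hn⟩ : ∃ n, n = Module.finrank ℝ V := ⟨_, rfl⟩
  have hnd : n ≤ d := by
    rw [hn]
    exact (Submodule.finrank_le V).trans (by simp)
  let e : OrthonormalBasis (Fin n) ℝ V := (stdOrthonormalBasis ℝ V).reindex (finCongr hn.symm)
  let v : Fin d → EuclideanSpace ℝ (Fin d) := fun i => if h : (i : ℕ) < n then e ⟨i, h⟩ else 0
  have hv : Orthonormal ℝ (Set.domRestrict {i : Fin d | (i : ℕ) < n} v) := by
    have h1 : Set.domRestrict {i : Fin d | (i : ℕ) < n} v =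
        (fun i : Fin n => (e i : EuclideanSpace ℝ (Fin d))) ∘ fun i => ⟨i.1, i.2⟩ := by
      funext ⟨i, hi⟩
      have hi' : (i : ℕ) < n := hi
      simp [v, hi']
    rw [h1]
    refine (e.orthonormal.comp_linearIsometry V.subtypeₗᵢ).comp _ ?_
    intro i j hij
    exact Subtype.ext (Fin.ext (by simpa using hij))
  obtain ⟨b, hb⟩ := hv.exists_orthonormalBasis_extension_of_card_eq (by simp)
  have hbe : ∀ i : Fin n, b (Fin.castLE hnd i) = e i := by
    intro i
    rw [hb _ (by simp)]
    simp [v]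
  have hbV : ∀ i : Fin n, b (Fin.castLE hnd i) ∈ V := fun i => hbe i ▸ (e i).2
  -- the remaining basis vectors are orthogonal to the range
  have hperp : ∀ i : Fin d, n ≤ i → ∀ y ∈ V, inner ℝ (b i) y = 0 := by
    intro i hi y hy
    have hy' : y = ∑ j, e.repr ⟨y, hy⟩ j • (e j : EuclideanSpace ℝ (Fin d)) := by
      have := congrArg Subtype.val (e.sum_repr ⟨y, hy⟩)
      simpa using this.symm
    rw [hy', inner_sum]
    refine Finset.sum_eq_zero fun j _ => ?_
    rw [inner_smul_right, ← hbe, b.inner_eq_zero, mul_zero]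
    intro hij
    rw [hij] at hi
    simp at hi
    omega
  have hker : ∀ x, (∀ y ∈ V, inner ℝ x y = 0) → B x = 0 := by
    intro x hx
    rw [← inner_self_eq_zero (𝕜 := ℝ), hB, hx _ ⟨_, rfl⟩, neg_zero]
  let A : Matrix (Fin n) (Fin n) ℝ := Matrix.of fun i j =>
    inner ℝ (b (Fin.castLE hnd i)) (B (b (Fin.castLE hnd j)))
  have hA : ∀ x i, inner ℝ (b (Fin.castLE hnd i)) (B x) =
      (A *ᵥ fun j => inner ℝ (b (Fin.castLE hnd j)) x) i := by
    intro x i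
    have hx : B (x - ∑ j : Fin n, inner ℝ (b (Fin.castLE hnd j)) x • b (Fin.castLE hnd j)) = 0 := by
      refine hker _ fun y hy => ?_
      have hy' : y = ∑ j, e.repr ⟨y, hy⟩ j • b (Fin.castLE hnd j) := by
        have := congrArg Subtype.val (e.sum_repr ⟨y, hy⟩)
        simpa [hbe] using this.symm
      rw [hy', inner_sum]
      refine Finset.sum_eq_zero fun j _ => ?_
      rw [inner_smul_right, inner_sub_left, sum_inner]
      have : ∀ l : Fin n, inner ℝ (inner ℝ (b (Fin.castLE hnd l)) x • b (Fin.castLE hnd l))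
          (b (Fin.castLE hnd j)) = if l = j then inner ℝ (b (Fin.castLE hnd l)) x else 0 := by
        intro l
        rw [real_inner_smul_left, b.inner_eq_ite]
        simp [Fin.ext_iff]
      rw [Finset.sum_congr rfl fun l _ => this l, Finset.sum_ite_eq', if_pos (Finset.mem_univ j),
        real_inner_comm, sub_self, mul_zero]
    rw [map_sub, sub_eq_zero, map_sum] at hx
    rw [hx, inner_sum]
    simp only [Matrix.mulVec, dotProduct, A, Matrix.of_apply, map_smul, inner_smul_right]
    exact Finset.sum_congr rfl fun j _ => mul_comm _ _
  have hskew : Aᵀ = -A := by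
    ext i j
    simp only [A, Matrix.transpose_apply, Matrix.neg_apply, Matrix.of_apply]
    rw [real_inner_comm, hB]
  have hunit : IsUnit A := by
    rw [← Matrix.mulVec_injective_iff_isUnit]
    refine (injective_iff_map_eq_zero (Matrix.mulVecLin A)).2 fun z hz => ?_
    have hz' : A *ᵥ z = 0 := hz
    set x := ∑ j : Fin n, z j • b (Fin.castLE hnd j) with hx
    have hxi : (fun j => inner ℝ (b (Fin.castLE hnd j)) x) = z := by
      funext j
      rw [hx, inner_sum]
      simp [inner_smul_right, b.inner_eq_ite, Fin.ext_iff]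
      simp [← Fin.ext_iff]
    have hxV : x ∈ V := Submodule.sum_mem _ fun j _ => Submodule.smul_mem _ _ (hbV j)
    have hBx : B x = 0 := by
      have h : ∀ i, inner ℝ (b i) (B x) = 0 := by
        intro i
        by_cases hi : (i : ℕ) < n
        · have := hA x ⟨i, hi⟩
          rw [hxi, hz'] at this
          simpa using this
        · exact hperp i (not_lt.1 hi) _ ⟨x, rfl⟩
      rw [← b.sum_repr' (B x)]
      simp [h]
    obtain ⟨y, hy⟩ := hxV
    have hx0 : x = 0 := by
      rw [← inner_self_eq_zero (𝕜 := ℝ)]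
      conv_lhs => rw [← hy, hB, hy, hBx]
      simp
    rw [← hxi, hx0]
    funext j
    simp
  obtain ⟨k, rfl⟩ := even_iff_two_dvd.1 (even_of_skew_invertible hunit hskew)
  exact ⟨k, hnd, b, A, hunit, hskew, hA, fun x i hi => hperp i hi _ ⟨x, rfl⟩⟩

end Skew

/-! ### Linear differential equations with constant coefficients -/

section Exponential

variable {n : ℕ}

open scoped Matrix.Norms.Operator in
lemma hasDerivAt_exp_entry (A : Matrix (Fin n) (Fin n) ℝ) (i j : Fin n) (t : ℝ) :
    HasDerivAt (fun t : ℝ => NormedSpace.exp (t • A) i j)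
      ((NormedSpace.exp (t • A) * A) i j) t := by
  have h : HasDerivAt (fun u : ℝ => NormedSpace.exp (u • A)) (NormedSpace.exp (t • A) * A) t :=
    hasDerivAt_exp_smul_const (𝕂 := ℝ) A t
  exact hasDerivAt_pi.1 (hasDerivAt_pi.1 h i) j

lemma contDiff_exp_entry (A : Matrix (Fin n) (Fin n) ℝ) (i j : Fin n) :
    ContDiff ℝ ∞ (fun t : ℝ => NormedSpace.exp (t • A) i j) := by
  rw [contDiff_infty]
  intro m
  induction m generalizing i j with
  | zero =>
    rw [Nat.cast_zero, contDiff_zero]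
    exact continuous_iff_continuousAt.2 fun t => (hasDerivAt_exp_entry A i j t).continuousAt
  | succ m ih =>
    push_cast
    rw [contDiff_succ_iff_deriv]
    refine ⟨fun t => (hasDerivAt_exp_entry A i j t).differentiableAt, by simp, ?_⟩
    have h : deriv (fun t : ℝ => NormedSpace.exp (t • A) i j) =
        fun t => ∑ l, NormedSpace.exp (t • A) i l * A l j :=
      funext fun t => (hasDerivAt_exp_entry A i j t).deriv
    rw [h]
    exact ContDiff.sum fun l _ => (ih i l).mul contDiff_const

lemma exp_add_smul (A : Matrix (Fin n) (Fin n) ℝ) (s t : ℝ) :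
    NormedSpace.exp ((s + t) • A) = NormedSpace.exp (s • A) * NormedSpace.exp (t • A) := by
  rw [add_smul]
  exact Matrix.exp_add_of_commute _ _ (((Commute.refl A).smul_left s).smul_right t)

/-- Solutions of `u' = A u` on an interval. -/
lemma eq_exp_mulVec {J : Set ℝ} (hJ : IsOpenInterval J) {A : Matrix (Fin n) (Fin n) ℝ}
    {u : ℝ → Fin n → ℝ} (hu : ∀ t ∈ J, ∀ i, HasDerivAt (fun t => u t i) ((A *ᵥ u t) i) t) :
    ∃ v, ∀ t ∈ J, u t = NormedSpace.exp (t • A) *ᵥ v := by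
  -- variation of constants: `exp (-t A) u t` is constant
  have hd : ∀ i, ∀ t ∈ J, HasDerivAt (fun t => (NormedSpace.exp (t • (-A)) *ᵥ u t) i) 0 t := by
    intro i t ht
    have h := HasDerivAt.fun_sum (u := Finset.univ) fun j _ =>
      (hasDerivAt_exp_entry (-A) i j t).mul (hu t ht j)
    refine h.congr_deriv ?_
    rw [Finset.sum_add_distrib]
    change ((NormedSpace.exp (t • (-A)) * -A) *ᵥ u t) i +
      (NormedSpace.exp (t • (-A)) *ᵥ (A *ᵥ u t)) i = 0
    rw [Matrix.mulVec_mulVec, mul_neg, Matrix.neg_mulVec, Pi.neg_apply, neg_add_cancel]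
  choose v hv using fun i => hJ.2.1.exists_is_const_of_deriv_eq_zero hJ.isPreconnected
    (fun t ht => (hd i t ht).differentiableAt.differentiableWithinAt) fun t ht => (hd i t ht).deriv
  refine ⟨v, fun t ht => ?_⟩
  have h : NormedSpace.exp (t • (-A)) *ᵥ u t = v := funext fun i => hv i t ht
  have h1 : NormedSpace.exp (t • A) * NormedSpace.exp (t • (-A)) = 1 := by
    rw [smul_neg, ← neg_smul, ← exp_add_smul, add_neg_cancel, zero_smul, NormedSpace.exp_zero]
  rw [← h, Matrix.mulVec_mulVec, h1, Matrix.one_mulVec]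

end Exponential

/-! ### Classification of the curves with translation invariant distances -/

section Classification

variable {d : ℕ} {J : Set ℝ} {c : ℝ → EuclideanSpace ℝ (Fin d)}

lemma deriv_mem_span {f : ℝ → EuclideanSpace ℝ (Fin d)} (hJ : IsOpen J)
    (hf : ContDiffOn ℝ ∞ f J) {t : ℝ} (ht : t ∈ J) :
    deriv f t ∈ Submodule.span ℝ (Set.range fun s : J => f s) := by
  rw [← Submodule.orthogonal_orthogonal (Submodule.span ℝ (Set.range fun s : J => f s)),
    Submodule.mem_orthogonal]
  intro y hy
  have h1 := (hasDerivAt_const t y).inner ℝ (hasDerivAt_of_contDiffOn hJ hf ht)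
  have h2 : (fun s => inner ℝ y (f s)) =ᶠ[nhds t] fun _ => 0 :=
    Filter.eventually_of_mem (hJ.mem_nhds ht) fun s hs =>
      Submodule.inner_left_of_mem_orthogonal
        (Submodule.subset_span (Set.mem_range_self (f := fun s : J => f s) ⟨s, hs⟩)) hy
  have h3 := h1.unique ((hasDerivAt_const t (0 : ℝ)).congr_of_eventuallyEq h2)
  simpa using h3

/-- A curve whose velocity is an affine function with skew-symmetric linear part of the position
is a generalized helix. -/
lemma isGeneralizedHelix_of_skew_ode (hJ : IsOpenInterval J)
    {B : EuclideanSpace ℝ (Fin d) →ₗ[ℝ] EuclideanSpace ℝ (Fin d)}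
    (hB : ∀ x y, inner ℝ (B x) y = -inner ℝ x (B y)) {w₀ : EuclideanSpace ℝ (Fin d)}
    (hc : ∀ t ∈ J, HasDerivAt c (B (c t) + w₀) t) : IsGeneralizedHelix (c '' J) := by
  obtain ⟨k, hk, b, A, hA, hskew, hbA, hb0⟩ := exists_adapted_basis hB
  have hder : ∀ i : Fin d, ∀ t ∈ J, HasDerivAt (fun t => inner ℝ (b i) (c t))
      (inner ℝ (b i) (B (c t)) + inner ℝ (b i) w₀) t := fun i t ht =>
    ((hasDerivAt_const t (b i)).inner ℝ (hc t ht)).congr_deriv (by simp [inner_add_right])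
  -- the components in the range of `B`, shifted so that the equation becomes homogeneous
  let q : Fin (2 * k) → ℝ := A⁻¹ *ᵥ fun i => inner ℝ (b (Fin.castLE hk i)) w₀
  have hq : ∀ i, (A *ᵥ q) i = inner ℝ (b (Fin.castLE hk i)) w₀ := fun i => by
    rw [Matrix.mulVec_mulVec, Matrix.mul_nonsing_inv _ ((Matrix.isUnit_iff_isUnit_det A).1 hA),
      Matrix.one_mulVec]
  obtain ⟨v, hv⟩ := eq_exp_mulVec hJ (A := A)
    (u := (fun t => (fun i => inner ℝ (b (Fin.castLE hk i)) (c t)) + q)) (by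
      intro t ht i
      refine ((hder (Fin.castLE hk i) t ht).add_const (q i)).congr_deriv ?_
      rw [Matrix.mulVec_add, Pi.add_apply, hq, hbA])
  -- the components in the kernel of `B`
  have hlin : ∀ i : Fin d, ∃ r, 2 * k ≤ (i : ℕ) → ∀ t ∈ J,
      inner ℝ (b i) (c t) = t * inner ℝ (b i) w₀ + r := by
    intro i
    by_cases hi : 2 * k ≤ (i : ℕ)
    · have hd : ∀ t ∈ J, HasDerivAt (fun t => inner ℝ (b i) (c t) - t * inner ℝ (b i) w₀) 0 t :=
        fun t ht => ((hder i t ht).sub ((hasDerivAt_id t).mul_const _)).congr_deriv (by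
          rw [hb0 _ i hi]
          simp)
      obtain ⟨r, hr⟩ := hJ.2.1.exists_is_const_of_deriv_eq_zero hJ.isPreconnected
        (fun t ht => (hd t ht).differentiableAt.differentiableWithinAt) fun t ht => (hd t ht).deriv
      exact ⟨r, fun _ t ht => by linarith [hr t ht]⟩
    · exact ⟨0, fun h => absurd h hi⟩
  choose r hr using hlin
  let o : EuclideanSpace ℝ (Fin d) :=
    WithLp.toLp 2 fun i : Fin d => if h : (i : ℕ) < 2 * k then -q ⟨i, h⟩ else r i
  let w : Fin (d - 2 * k) → ℝ := fun j => inner ℝ (b ⟨2 * k + j, by omega⟩) w₀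
  let R : EuclideanSpace ℝ (Fin d) ≃ᵃⁱ[ℝ] EuclideanSpace ℝ (Fin d) :=
    (AffineIsometryEquiv.constVAdd ℝ (EuclideanSpace ℝ (Fin d)) o).trans
      b.repr.symm.toAffineIsometryEquiv
  refine ⟨k, d - 2 * k, A, v, w, J, R, by omega, hA, hskew, hJ, Set.image_congr fun t ht => ?_⟩
  have hR : R (helixPoint d k (d - 2 * k) A v w t) =
      b.repr.symm (o + helixPoint d k (d - 2 * k) A v w t) := rfl
  rw [hR, LinearIsometryEquiv.eq_symm_apply]
  ext i
  rw [b.repr_apply_apply, PiLp.add_apply]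
  by_cases hi : (i : ℕ) < 2 * k
  · have h := congrFun (hv t ht) ⟨i, hi⟩
    simp only [Pi.add_apply] at h
    simp only [o, helixPoint, dif_pos hi]
    rw [← h]
    simp
  · have hi' : (i : ℕ) - 2 * k < d - 2 * k := by omega
    have hii : (⟨2 * k + (i - 2 * k), by omega⟩ : Fin d) = i := Fin.ext (by simp; omega)
    simp only [o, helixPoint, dif_neg hi, dif_pos hi', w]
    rw [hr i (not_lt.1 hi) t ht, hii, add_comm]

/-- A curve whose velocities at any two points satisfy the skew-symmetry of
`inner_second_deriv_skew` is a generalized helix: the acceleration is a skew-symmetric linear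
function of the velocity. -/
lemma isGeneralizedHelix_of_skew (hJ : IsOpenInterval J) (hc : ContDiffOn ℝ ∞ c J)
    (h : ∀ a ∈ J, ∀ b ∈ J, inner ℝ (deriv (deriv c) a) (deriv c b) =
      -inner ℝ (deriv c a) (deriv (deriv c) b)) : IsGeneralizedHelix (c '' J) := by
  have hc1 := contDiffOn_deriv hJ.2.1 hc
  obtain ⟨B, hB, hBT⟩ := exists_skew_extension (ι := J) (f := fun s => deriv c s)
    (g := fun s => deriv (deriv c) s) (fun i j => h i i.2 j j.2)
    fun i => deriv_mem_span hJ.2.1 hc1 i.2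
  have hd : ∀ t ∈ J, HasDerivAt (fun t => deriv c t - B (c t)) 0 t := fun t ht =>
    ((hasDerivAt_of_contDiffOn hJ.2.1 hc1 ht).sub
      (B.toContinuousLinearMap.hasFDerivAt.comp_hasDerivAt t
        (hasDerivAt_of_contDiffOn hJ.2.1 hc ht))).congr_deriv (by
          rw [← hBT ⟨t, ht⟩]
          simp)
  obtain ⟨w₀, hw₀⟩ := hJ.2.1.exists_is_const_of_deriv_eq_zero hJ.isPreconnected
    (fun t ht => (hd t ht).differentiableAt.differentiableWithinAt) fun t ht => (hd t ht).deriv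
  refine isGeneralizedHelix_of_skew_ode hJ hB (w₀ := w₀) fun t ht => ?_
  rw [← hw₀ t ht, add_sub_cancel]
  exact hasDerivAt_of_contDiffOn hJ.2.1 hc ht

end Classification

/-! ### Generalized helices are degenerate -/

section Helix

variable {d k l : ℕ} {A : Matrix (Fin (2 * k)) (Fin (2 * k)) ℝ} {v : Fin (2 * k) → ℝ}
  {w : Fin l → ℝ}

lemma contDiff_helixPoint : ContDiff ℝ ∞ (helixPoint d k l A v w) := by
  rw [contDiff_euclidean]
  intro i
  by_cases hi : (i : ℕ) < 2 * k
  · simp only [helixPoint, dif_pos hi]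
    simp only [Matrix.mulVec, dotProduct]
    exact ContDiff.sum fun j _ => (contDiff_exp_entry A _ j).mul contDiff_const
  · by_cases hi' : (i : ℕ) - 2 * k < l
    · simp only [helixPoint, dif_neg hi, dif_pos hi']
      exact contDiff_id.mul contDiff_const
    · simp only [helixPoint, dif_neg hi, dif_neg hi']
      exact contDiff_const

lemma exp_mulVec_dotProduct_self (hA : Aᵀ = -A) (t : ℝ) (x : Fin (2 * k) → ℝ) :
    (NormedSpace.exp (t • A) *ᵥ x) ⬝ᵥ (NormedSpace.exp (t • A) *ᵥ x) = x ⬝ᵥ x := by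
  have h : (NormedSpace.exp (t • A))ᵀ * NormedSpace.exp (t • A) = 1 := by
    rw [← Matrix.exp_transpose, Matrix.transpose_smul, hA, smul_neg, ← neg_smul, ← exp_add_smul,
      neg_add_cancel, zero_smul, NormedSpace.exp_zero]
  rw [Matrix.dotProduct_mulVec, ← Matrix.mulVec_transpose, Matrix.mulVec_mulVec, h,
    Matrix.one_mulVec]

/-- Translations of the parameter preserve the distances of a generalized helix. -/
lemma sqDist_helixPoint_add (hd : l + 2 * k ≤ d) (hA : Aᵀ = -A) (a b t : ℝ) :
    sqDist (helixPoint d k l A v w (a + t)) (helixPoint d k l A v w (b + t)) =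
      sqDist (helixPoint d k l A v w a) (helixPoint d k l A v w b) := by
  obtain ⟨m, rfl⟩ : ∃ m, d = 2 * k + m := ⟨d - 2 * k, by omega⟩
  have h1 : ∀ a b, ∑ i : Fin (2 * k), (helixPoint (2 * k + m) k l A v w a (Fin.castAdd m i) -
      helixPoint (2 * k + m) k l A v w b (Fin.castAdd m i)) ^ 2 =
      (NormedSpace.exp (a • A) *ᵥ v - NormedSpace.exp (b • A) *ᵥ v) ⬝ᵥ
        (NormedSpace.exp (a • A) *ᵥ v - NormedSpace.exp (b • A) *ᵥ v) := by
    intro a b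
    refine Finset.sum_congr rfl fun i _ => ?_
    simp [helixPoint, sq]
  have h2 : ∀ i : Fin m, helixPoint (2 * k + m) k l A v w (a + t) (Fin.natAdd (2 * k) i) -
      helixPoint (2 * k + m) k l A v w (b + t) (Fin.natAdd (2 * k) i) =
      helixPoint (2 * k + m) k l A v w a (Fin.natAdd (2 * k) i) -
      helixPoint (2 * k + m) k l A v w b (Fin.natAdd (2 * k) i) := by
    intro i
    by_cases hi : (i : ℕ) < l
    · simp [helixPoint, hi]
      ring
    · simp [helixPoint, hi]
  have h3 : ∀ s, NormedSpace.exp ((s + t) • A) *ᵥ v =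
      NormedSpace.exp (t • A) *ᵥ (NormedSpace.exp (s • A) *ᵥ v) := fun s => by
    rw [Matrix.mulVec_mulVec, ← exp_add_smul, add_comm]
  simp only [sqDist, EuclideanSpace.real_norm_sq_eq, PiLp.sub_apply, Fin.sum_univ_add, h1, h2, h3]
  rw [← Matrix.mulVec_sub, exp_mulVec_dotProduct_self hA]

/-- A generalized helix which stops moving during some time is a point. -/
lemma helixPoint_eq_of_locally_eq (hd : l + 2 * k ≤ d) (hA : Aᵀ = -A) {τ δ : ℝ} (hδ : 0 < δ)
    (h : ∀ t ∈ Set.Ioo (-δ) δ, helixPoint d k l A v w (τ + t) = helixPoint d k l A v w τ)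
    (a b : ℝ) : helixPoint d k l A v w a = helixPoint d k l A v w b := by
  have hloc : IsLocallyConstant (helixPoint d k l A v w) := by
    rw [IsLocallyConstant.iff_eventually_eq]
    intro a
    filter_upwards [Metric.ball_mem_nhds a hδ] with s hs
    have h1 := sqDist_helixPoint_add (v := v) (w := w) hd hA (τ + (s - a)) τ (a - τ)
    rw [h (s - a) (by simpa [Real.dist_eq, abs_lt] using hs), sqDist_eq_zero_iff.2 rfl,
      sqDist_eq_zero_iff] at h1
    rwa [show τ + (s - a) + (a - τ) = s by ring, add_sub_cancel] at h1
  exact hloc.apply_eq_of_isPreconnected isPreconnected_univ trivial trivial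

/-- Every framework on a generalized helix with more than one point can be moved by translating
the parameter. -/
lemma IsGeneralizedHelix.isDegenerate {V : Type*} [Finite V] [Nonempty V] {G : SimpleGraph V}
    {Γ : Set (EuclideanSpace ℝ (Fin d))} (h : IsGeneralizedHelix Γ) (hΓ : Γ.Nontrivial) :
    IsDegenerate sqDist G Γ := by
  obtain ⟨k, l, A, v, w, J, R, hd, -, hA, hJ, rfl⟩ := h
  intro φ _ hφ
  choose s hsJ hs using hφ
  obtain ⟨δ, hδ, hδJ⟩ : ∃ δ > 0, ∀ i, ∀ t ∈ Set.Ioo (-δ) δ, s i + t ∈ J := by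
    have h1 : ∀ i, ∀ᶠ t in nhds (0 : ℝ), s i + t ∈ J := fun i => by
      have : Filter.Tendsto (fun t => s i + t) (nhds 0) (nhds (s i)) := by
        simpa using (continuous_const_add (s i)).tendsto 0
      exact this (hJ.2.1.mem_nhds (hsJ i))
    obtain ⟨δ, hδ, hsub⟩ := Metric.eventually_nhds_iff_ball.1 (Filter.eventually_all.2 h1)
    refine ⟨δ, hδ, fun i t ht => hsub t ?_ i⟩
    rwa [Real.ball_eq_Ioo, zero_sub, zero_add]
  refine ⟨δ, fun i t => R (helixPoint d k l A v w (s i + t)), hδ,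
    fun i t ht => ⟨_, hδJ i t ht, rfl⟩, fun i => ContDiff.contDiffOn ?_, fun i => ?_, ?_, ?_⟩
  · exact R.toAffineIsometry.toContinuousAffineMap.contDiff.comp
      (contDiff_helixPoint.comp (contDiff_const.add contDiff_id))
  · simpa using hs i
  · by_contra! hcon
    obtain ⟨_, ⟨a, -, rfl⟩, _, ⟨b, -, rfl⟩, hne⟩ := hΓ
    obtain ⟨i⟩ := ‹Nonempty V›
    refine hne (congrArg R (helixPoint_eq_of_locally_eq hd hA hδ (τ := s i) (fun t ht => ?_) a b))
    exact R.injective ((hcon t ht i).trans (hs i).symm)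
  · intro i j _ t _
    have hR : ∀ x y, sqDist (R x) (R y) = sqDist x y := fun x y => by
      simp [sqDist, ← dist_eq_norm]
    simp only [← hs, hR]
    exact sqDist_helixPoint_add hd hA _ _ _

end Helix

/-! ### Degenerate simple curves are generalized helices -/

section Main

variable {d : ℕ} {I : Set ℝ} {γ : ℝ → EuclideanSpace ℝ (Fin d)}

/-- The submersion condition, in terms of the partial derivatives. -/
lemma inner_deriv_ne_zero_of_fderiv_sqDist {a b : ℝ} (ha : DifferentiableAt ℝ γ a)
    (hb : DifferentiableAt ℝ γ b)
    (h : fderiv ℝ (fun p : ℝ × ℝ => sqDist (γ p.1) (γ p.2)) (a, b) ≠ 0) :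
    inner ℝ (deriv γ a) (γ a - γ b) ≠ 0 ∨ inner ℝ (deriv γ b) (γ b - γ a) ≠ 0 := by
  by_contra! hcon
  refine h (HasFDerivAt.fderiv ?_)
  have h1 := HasFDerivAt.comp (a, b) (f := Prod.fst) (g := γ) ha.hasDerivAt.hasFDerivAt
    (hasFDerivAt_fst (𝕜 := ℝ) (E := ℝ) (F := ℝ))
  have h2 := HasFDerivAt.comp (a, b) (f := Prod.snd) (g := γ) hb.hasDerivAt.hasFDerivAt
    (hasFDerivAt_snd (𝕜 := ℝ) (E := ℝ) (F := ℝ))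
  have h3 : inner ℝ (γ a - γ b) (deriv γ a) = 0 := by rw [real_inner_comm]; exact hcon.1
  have h4 : inner ℝ (γ a - γ b) (deriv γ b) = 0 := by
    rw [real_inner_comm, ← neg_sub, inner_neg_right, hcon.2, neg_zero]
  refine (h1.sub h2).norm_sq.congr_fderiv ?_
  rw [inner_sub_left] at h3 h4
  ext
  · simp [h3]
  · simp
    linarith

/-- The submersion condition passes to the parametrization by arc length, whose velocity is a
positive multiple of the velocity of `γ`. -/
lemma halfSlope_ne_zero (hI : IsOpen I) (hγ : ContDiffOn ℝ ∞ γ I) (hreg : ∀ t ∈ I, deriv γ t ≠ 0)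
    (hsub : ∀ a ∈ I, ∀ b ∈ I, a ≠ b →
      fderiv ℝ (fun p : ℝ × ℝ => sqDist (γ p.1) (γ p.2)) (a, b) ≠ 0)
    {J : Set ℝ} {τ : ℝ → ℝ} (hτ : Set.BijOn τ J I)
    (hd : ∀ t ∈ J, HasDerivAt (γ ∘ τ) (‖deriv γ (τ t)‖⁻¹ • deriv γ (τ t)) t)
    {a b : ℝ} (ha : a ∈ J) (hb : b ∈ J) (hab : a ≠ b) :
    halfSlope (γ ∘ τ) a b ≠ 0 ∨ halfSlope (γ ∘ τ) b a ≠ 0 := by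
  have hdiff : ∀ t ∈ I, DifferentiableAt ℝ γ t := fun t ht =>
    (hasDerivAt_of_contDiffOn hI hγ ht).differentiableAt
  have hpos : ∀ t ∈ J, ‖deriv γ (τ t)‖⁻¹ ≠ 0 := fun t ht =>
    inv_ne_zero (norm_ne_zero_iff.2 (hreg _ (hτ.mapsTo ht)))
  simp only [halfSlope, (hd a ha).deriv, (hd b hb).deriv, real_inner_smul_left,
    Function.comp_apply, ne_eq, mul_eq_zero, hpos a ha, hpos b hb, false_or]
  exact inner_deriv_ne_zero_of_fderiv_sqDist (hdiff _ (hτ.mapsTo ha)) (hdiff _ (hτ.mapsTo hb))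
    (hsub _ (hτ.mapsTo ha) _ (hτ.mapsTo hb) fun h => hab (hτ.injOn ha hb h))

/-- A degenerate curve whose squared distance is a submersion off the diagonal is a generalized
helix. -/
lemma IsDegenerate.isGeneralizedHelix (hI : IsOpenInterval I) (hγ : ContDiffOn ℝ ∞ γ I)
    (hinj : Set.InjOn γ I) (hreg : ∀ t ∈ I, deriv γ t ≠ 0)
    (hsub : ∀ a ∈ I, ∀ b ∈ I, a ≠ b →
      fderiv ℝ (fun p : ℝ × ℝ => sqDist (γ p.1) (γ p.2)) (a, b) ≠ 0)
    (hdeg : IsDegenerate sqDist triangle (γ '' I)) : IsGeneralizedHelix (γ '' I) := by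
  obtain ⟨J, τ, hJ, hc, hτ, hd, hunit⟩ := exists_unitSpeed hI hγ hreg
  have himg : γ '' I = (γ ∘ τ) '' J := by rw [Set.image_comp, hτ.image_eq]
  rw [himg] at hdeg ⊢
  have hcinj : Set.InjOn (γ ∘ τ) J := hinj.comp hτ.injOn hτ.mapsTo
  refine isGeneralizedHelix_of_skew hJ hc fun a ha b hb =>
    inner_second_deriv_skew hJ.2.1 hc hunit (fun a ha b hb => ?_) ha hb
  exact halfSlope_add_eq_zero hJ hc hunit
    (fun a ha b hb e he hab hae hbe => cyclic_halfSlope hJ.2.1 hc hcinj hdeg ha hb he hab hae hbe)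
    (fun a ha b hb hab => halfSlope_ne_zero hI.2.1 hγ hreg hsub hτ hd ha hb hab) ha hb

lemma nontrivial_image_of_injOn (hI : IsOpenInterval I) (hinj : Set.InjOn γ I) :
    (γ '' I).Nontrivial := by
  obtain ⟨⟨t, ht⟩, hIo, -⟩ := hI
  exact (infinite_of_mem_nhds t (hIo.mem_nhds ht)).nontrivial.image_of_injOn hinj

end Main

end CurveRigidity

theorem corollary6p3 {d : ℕ} (I : Set ℝ) (hI : CurveRigidity.IsOpenInterval I)
    (γ : ℝ → EuclideanSpace ℝ (Fin d)) (hγ : AnalyticOnNhd ℝ γ I)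
    (hreg : ∀ t ∈ I, deriv γ t ≠ 0)
    (hsimple : CurveRigidity.IsSimplePair CurveRigidity.sqDist I γ) :
    CurveRigidity.IsDegenerate CurveRigidity.sqDist CurveRigidity.triangle (γ '' I) ↔
      CurveRigidity.IsGeneralizedHelix (γ '' I) :=
  ⟨CurveRigidity.IsDegenerate.isGeneralizedHelix hI (hγ.contDiffOn hI.2.1.uniqueDiffOn)
      hsimple.injOn hreg hsimple.submersion,
    fun h => h.isDegenerate (CurveRigidity.nontrivial_image_of_injOn hI hsimple.injOn)⟩
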